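/- Let $X$ be a complex Banach space and let $T\in L(X)$ be a bounded linear operator on $X$. For $S$ a bounded operator on a complex Banach space, let $\sigma(S)$ be its spectrum, let $\sigma_b(S)$ (Browder spectrum) be the set of $\lambda\in\mathbb{C}$ such that $S-\lambda I$ is not a Fredholm operator of finite ascent and finite descent, and let $\sigma_d(S)$ (Drazin spectrum) be the set of $\lambda\in\mathbb{C}$ such that $S-\lambda I$ is not Drazin invertible, i.e. does not have both finite ascent and finite descent. For $A\subset\mathbb{C}$ and an ordinal $\alpha$, the Cantor–Bendixson derivatives are defined by $\mathrm{acc}^0A=A$, $\mathrm{acc}^{\alpha+1}A=\mathrm{acc}(\mathrm{acc}^{\alpha}A)$, where $\mathrm{acc}\,B$ is the set of accumulation points of $B$ in $\mathbb{C}$, and $\mathrm{acc}^{\alpha}A=\bigcap_{\beta<\alpha}\mathrm{acc}^{\beta}A$ for $\alpha$ a limit ordinal. Write $(M,N)\in\mathrm{Red}(T)$ if $M,N$ are closed $T$-invariant subspaces with $X=M\oplus N$, and let $T_M,T_N$ be the restrictions of $T$ to $M$ and $N$. Let $\sigma_*\in\{\sigma,\sigma_b,\sigma_d\}$. The operator $T$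 is called - $g^0_{\sigma_*}$-invertible if $0\notin\sigma_*(T)$; - $g^{\alpha+1}_{\sigma_*}$-invertible if there is $(M,N)\in\mathrm{Red}(T)$ such that $T_M$ is invertible and $\mathrm{acc}^{\alpha}\sigma_*(T_N)\subset\{0\}$; - $g^{\alpha}_{\sigma_*}$-invertible, for $\alpha$ a limit ordinal, if it is $g^{\beta}_{\sigma_*}$-invertible for some successor ordinal $\beta<\alpha$. Let $\omega$ be the first infinite ordinal and $\omega_1$ the first uncountable ordinal. Then: (i) For every $\sigma_*\in\{\sigma,\sigma_b,\sigma_d\}$ and every ordinal $\alpha\ge\omega_1$, $T$ is $g^{\alpha}_{\sigma_*}$-invertible if and only if $T$ is $g^{\beta}_{\sigma_*}$-invertible for some ordinal $\beta<\omega_1$. (ii) For all $\sigma_*,\sigma_{**}\in\{\sigma,\sigma_b,\sigma_d\}$ and every ordinal $\alpha\ge\omega$, $T$ is $g^{\alpha}_{\sigma_*}$-invertible if and only if $T$ is $g^{\alpha}_{\sigma_{**}}$-invertible. -/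

import Mathlib

open scoped Ordinal

universe u v

namespace CantorBendixsonInvertibility

/-- The `α`-th Cantor-Bendixson derivative `acc^α A` of a set `A` of complex numbers:
`acc^0 A = A`, `acc^(α+1) A` is the set of accumulation points of `acc^α A`, and at a limit
ordinal one takes the intersection of all earlier derivatives. -/
noncomputable def accIter (A : Set ℂ) (α : Ordinal.{v}) : Set ℂ :=
  Ordinal.limitRecOn α A (fun _ B => derivedSet B) (fun _ _ F => ⋂ β, ⋂ h, F β h)

section Operators

variable {X : Type u} [NormedAddCommGroup X] [NormedSpace ℂ X]

/-- `T` has finite ascent: the kernels of the powers of `T` stabilize. -/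
def HasFiniteAscent (T : X →L[ℂ] X) : Prop :=
  ∃ p : ℕ, (T ^ p).ker = (T ^ (p + 1)).ker

/-- `T` has finite descent: the ranges of the powers of `T` stabilize. -/
def HasFiniteDescent (T : X →L[ℂ] X) : Prop :=
  ∃ q : ℕ, (T ^ q).range = (T ^ (q + 1)).range

/-- Drazin invertible operators: finite ascent and finite descent. -/
def IsDrazinInvertible (T : X →L[ℂ] X) : Prop :=
  HasFiniteAscent T ∧ HasFiniteDescent T

/-- Browder operators: Fredholm operators of finite ascent and finite descent. -/
def IsBrowder (T : X →L[ℂ] X) : Prop :=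
  T.IsFredholm ∧ HasFiniteAscent T ∧ HasFiniteDescent T

/-- The Browder spectrum `σ_b(T)`. -/
def browderSpectrum (T : X →L[ℂ] X) : Set ℂ :=
  {z | ¬ IsBrowder (T - z • (1 : X →L[ℂ] X))}

/-- The Drazin spectrum `σ_d(T)`. -/
def drazinSpectrum (T : X →L[ℂ] X) : Set ℂ :=
  {z | ¬ IsDrazinInvertible (T - z • (1 : X →L[ℂ] X))}

end Operators

/-- The three choices for `σ_*`: the spectrum `σ`, the Browder spectrum `σ_b` and the Drazin
spectrum `σ_d`. -/
inductive SpectrumKind : Type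
  | ordinary
  | browder
  | drazin

section GInvertible

variable {X : Type u} [NormedAddCommGroup X] [NormedSpace ℂ X]

/-- `σ_*(T)` for the given choice of `σ_*`. -/
def SpectrumKind.spec (s : SpectrumKind) (T : X →L[ℂ] X) : Set ℂ :=
  match s with
  | .ordinary => spectrum ℂ T
  | .browder => browderSpectrum T
  | .drazin => drazinSpectrum T

/-- `(M, N) ∈ Red(T)`: `M` and `N` are closed `T`-invariant subspaces and `X = M ⊕ N`. -/
structure IsRed (T : X →L[ℂ] X) (M N : Submodule ℂ X) : Prop where
  isClosed_left : IsClosed (M : Set X)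
  isClosed_right : IsClosed (N : Set X)
  invariant_left : ∀ x ∈ M, T x ∈ M
  invariant_right : ∀ x ∈ N, T x ∈ N
  isCompl : IsCompl M N

/-- `g^α_{σ_*}`-invertibility of `T`. The second clause is the one for the successor ordinal
`β + 1`; the third one, for a limit ordinal `α`, asks for `g^(β+1)_{σ_*}`-invertibility for some
successor ordinal `β + 1 < α`. -/
noncomputable def IsGInvertible (s : SpectrumKind) (α : Ordinal.{v}) (T : X →L[ℂ] X) : Prop :=
  Ordinal.limitRecOn α
    (0 ∉ s.spec T)
    (fun β _ => ∃ (M N : Submodule ℂ X) (h : IsRed T M N),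
      IsUnit (T.restrict h.invariant_left) ∧
        accIter (s.spec (T.restrict h.invariant_right)) β ⊆ {0})
    (fun α _ G => ∃ (β : Ordinal.{v}) (h : β + 1 < α), G (β + 1) h)

end GInvertible

end CantorBendixsonInvertibility

/-! For (i): ℂ is second countable, so the derivatives of a closed set are constant from some
countable stage on (`exists_lt_omega_one_accIter_eq`), and the same pair `(M, N)` then serves at a
countable order. The converse is monotonicity in the order. For (ii): a Drazin invertible operator
splits as invertible plus nilpotent, whence `acc σ ⊆ σ_d ⊆ σ_* ⊆ σ`. The derivatives of any two of
the spectra thus lag at most one step behind each other, and a limit ordinal absorbs this lag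
(`accIter_spec_eq`). -/

namespace CantorBendixsonInvertibility

/-! ### Cantor–Bendixson derivatives of closed sets -/

section Derivatives

lemma accIter_zero (A : Set ℂ) : accIter A (0 : Ordinal.{v}) = A :=
  Ordinal.limitRecOn_zero ..

lemma accIter_add_one (A : Set ℂ) (α : Ordinal.{v}) :
    accIter A (α + 1) = derivedSet (accIter A α) :=
  Ordinal.limitRecOn_add_one ..

lemma accIter_limit (A : Set ℂ) {α : Ordinal.{v}} (h : Order.IsSuccLimit α) :
    accIter A α = ⋂ β < α, accIter A β :=
  Ordinal.limitRecOn_limit _ _ _ _ h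

lemma derivedSet_subset {A : Set ℂ} (h : IsClosed A) : derivedSet A ⊆ A :=
  (isClosed_iff_derivedSet_subset A).1 h

lemma isClosed_derivedSet {A : Set ℂ} (h : IsClosed A) : IsClosed (derivedSet A) :=
  (isClosed_iff_derivedSet_subset _).2 (derivedSet_mono _ _ (derivedSet_subset h))

lemma isClosed_accIter {A : Set ℂ} (h : IsClosed A) (α : Ordinal.{v}) :
    IsClosed (accIter A α) := by
  induction α using Ordinal.limitRecOn with
  | zero => rwa [accIter_zero]
  | add_one α ih => rw [accIter_add_one]; exact isClosed_derivedSet ih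
  | limit α hα ih => rw [accIter_limit _ hα]; exact isClosed_biInter ih

lemma accIter_antitone {A : Set ℂ} (h : IsClosed A) :
    Antitone (accIter A : Ordinal.{v} → Set ℂ) := by
  intro β α hβα
  induction α using Ordinal.limitRecOn with
  | zero => rw [nonpos_iff_eq_zero.1 hβα]
  | add_one α ih =>
    rcases hβα.eq_or_lt with rfl | hlt
    · exact le_rfl
    · rw [accIter_add_one]
      exact (derivedSet_subset (isClosed_accIter h α)).trans (ih (Order.lt_add_one_iff.1 hlt))
  | limit α hα ih =>
    rcases hβα.eq_or_lt with rfl | hlt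
    · exact le_rfl
    · rw [accIter_limit _ hα]
      exact Set.biInter_subset_of_mem hlt

/-- If `acc A ⊆ B`, the derivatives of `B` lag behind those of `A` by at most one step. -/
lemma accIter_add_one_subset {A B : Set ℂ} (h : derivedSet A ⊆ B) (hA : IsClosed A)
    (α : Ordinal.{v}) : accIter A (α + 1) ⊆ accIter B α := by
  induction α using Ordinal.limitRecOn with
  | zero => rwa [accIter_add_one, accIter_zero, accIter_zero]
  | add_one α ih =>
    rw [accIter_add_one, accIter_add_one B]
    exact derivedSet_mono _ _ ih
  | limit α hα ih =>
    rw [accIter_limit B hα]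
    exact Set.subset_iInter₂ fun β hβ =>
      (accIter_antitone hA (by gcongr)).trans (ih β hβ)

/-- In a second countable space a transfinite decreasing sequence of closed sets is stationary at
some countable stage. -/
lemma exists_lt_omega_one_eq_add_one {Y : Type*} [TopologicalSpace Y]
    [SecondCountableTopology Y] (F : Ordinal.{v} → Set Y) (hF : Antitone F)
    (hc : ∀ α, IsClosed (F α)) : ∃ γ < (ω₁ : Ordinal.{v}), F γ = F (γ + 1) := by
  by_contra! hne
  -- Each strict drop uses up a basic open set that meets `F γ` and misses `F (γ + 1)`. As `F`
  -- decreases, no basic set serves twice, so `ω₁` would embed in a countable basis.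
  have key : ∀ γ : Set.Iio (ω₁ : Ordinal.{v}), ∃ U : TopologicalSpace.countableBasis Y,
      (U.1 ∩ F γ).Nonempty ∧ U.1 ∩ F (γ + 1) = ∅ := by
    rintro ⟨γ, hγ⟩
    obtain ⟨x, hx, hx'⟩ := Set.exists_of_ssubset
      ((hF (le_add_of_nonneg_right zero_le_one)).lt_of_ne (hne γ hγ).symm)
    obtain ⟨U, hU, hxU, hUF⟩ := (TopologicalSpace.isBasis_countableBasis Y).exists_subset_of_mem_open
      (show x ∈ (F (γ + 1))ᶜ from hx') (hc _).isOpen_compl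
    exact ⟨⟨U, hU⟩, ⟨x, hxU, hx⟩, Set.disjoint_iff_inter_eq_empty.1
      (Set.subset_compl_iff_disjoint_right.1 hUF)⟩
  choose U hU hU' using key
  have hlt : ∀ β γ, β < γ → U β ≠ U γ := by
    intro β γ hβγ heq
    obtain ⟨x, hxU, hx⟩ := hU γ
    have : x ∈ (U β).1 ∩ F (β + 1) :=
      ⟨heq ▸ hxU, hF (Order.add_one_le_of_lt (show β.1 < γ.1 from hβγ)) hx⟩
    rw [hU'] at this
    exact this
  have hinj : Function.Injective U := by
    intro β γ h
    rcases lt_trichotomy β γ with hl | rfl | hl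
    · exact absurd h (hlt _ _ hl)
    · rfl
    · exact absurd h.symm (hlt _ _ hl)
  have : Countable (TopologicalSpace.countableBasis Y) :=
    (TopologicalSpace.countable_countableBasis Y).to_subtype
  have hcount : Countable (Set.Iio (ω₁ : Ordinal.{v})) := hinj.countable
  have := Cardinal.mk_le_aleph0_iff.2 hcount
  rw [Cardinal.mk_Iio_ordinal] at this
  simp at this

lemma exists_lt_omega_one_accIter_eq {A : Set ℂ} (h : IsClosed A) :
    ∃ γ < (ω₁ : Ordinal.{v}), ∀ α, γ ≤ α → accIter A α = accIter A γ := by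
  obtain ⟨γ, hγ, heq⟩ := exists_lt_omega_one_eq_add_one (accIter A) (accIter_antitone h)
    (isClosed_accIter h)
  refine ⟨γ, hγ, fun α hα => ?_⟩
  refine (accIter_antitone h hα).antisymm ?_
  induction α using Ordinal.limitRecOn with
  | zero => rw [nonpos_iff_eq_zero.1 hα]
  | add_one α ih =>
    rcases hα.eq_or_lt with rfl | hlt
    · exact le_rfl
    · rw [accIter_add_one, heq, accIter_add_one]
      exact derivedSet_mono _ _ (ih (Order.lt_add_one_iff.1 hlt))
  | limit α hα' ih =>
    rw [accIter_limit _ hα']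
    refine Set.subset_iInter₂ fun β hβ => ?_
    rcases le_total γ β with hγβ | hβγ
    · exact ih β hβ hγβ
    · exact accIter_antitone h hβγ

end Derivatives

/-! ### Core-nilpotent decomposition -/

section Decomposition

variable {X : Type u} [NormedAddCommGroup X] [NormedSpace ℂ X]

lemma ker_pow_add_eq {T : X →L[ℂ] X} {p : ℕ} (h : (T ^ p).ker = (T ^ (p + 1)).ker) (k : ℕ) :
    (T ^ (p + k)).ker = (T ^ p).ker := by
  induction k with
  | zero => rfl
  | succ k ih =>
    rw [← ih]
    ext x
    have := SetLike.ext_iff.1 h ((T ^ k) x)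
    simp only [LinearMap.mem_ker, ContinuousLinearMap.coe_coe] at this ⊢
    rw [show p + (k + 1) = (p + 1) + k by ring, pow_add _ (p + 1) k, pow_add _ p k]
    exact this.symm

lemma range_pow_add_eq {T : X →L[ℂ] X} {q : ℕ} (h : (T ^ q).range = (T ^ (q + 1)).range)
    (k : ℕ) : (T ^ (q + k)).range = (T ^ q).range := by
  induction k with
  | zero => rfl
  | succ k ih =>
    rw [← ih]
    have h1 : ∀ m, (T ^ (m + k)).range = (T ^ m).range.map (T ^ k : X →L[ℂ] X).toLinearMap := by
      intro m
      rw [add_comm, pow_add]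
      exact LinearMap.range_comp _ _
    rw [show q + (k + 1) = (q + 1) + k by ring, h1, h1, h]

/-- The core-nilpotent data of a Drazin invertible operator. -/
lemma IsDrazinInvertible.exists_pow {T : X →L[ℂ] X} (h : IsDrazinInvertible T) :
    ∃ n : ℕ, (T ^ (n + 1)).range = (T ^ n).range ∧ IsCompl (T ^ n).range (T ^ n).ker ∧
      (T ^ (n + 1)).ker = (T ^ n).ker := by
  obtain ⟨⟨p, hp⟩, q, hq⟩ := h
  have hker : ∀ k, (T ^ (p + q + k)).ker = (T ^ (p + q)).ker := fun k => by
    rw [add_assoc, ker_pow_add_eq hp, ker_pow_add_eq hp]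
  have hran : ∀ k, (T ^ (p + q + k)).range = (T ^ (p + q)).range := fun k => by
    rw [add_comm p q, add_assoc, range_pow_add_eq hq, range_pow_add_eq hq]
  refine ⟨p + q, hran 1, ?_, hker 1⟩
  generalize p + q = n at hker hran
  refine IsCompl.of_le ?_ ?_
  · rintro _ ⟨⟨y, rfl⟩, hy⟩
    have : y ∈ (T ^ (n + n)).ker := by
      rw [pow_add]; exact hy
    rw [hker] at this
    exact this
  · intro x _
    have : (T ^ n) x ∈ (T ^ (n + n)).range := by
      rw [hran]; exact ⟨x, rfl⟩
    obtain ⟨y, hy⟩ := this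
    rw [pow_add] at hy
    refine Submodule.mem_sup.2 ⟨(T ^ n) y, ⟨y, rfl⟩, x - (T ^ n) y, ?_, by simp⟩
    simp only [LinearMap.mem_ker, ContinuousLinearMap.coe_coe, map_sub]
    exact sub_eq_zero.2 hy.symm

/-- An operator range with a closed algebraic complement is closed. -/
lemma isClosed_range_of_isCompl {E F : Type*} [NormedAddCommGroup E] [NormedSpace ℂ E]
    [CompleteSpace E] [NormedAddCommGroup F] [NormedSpace ℂ F] [CompleteSpace F]
    (S : E →L[ℂ] F) {K : Submodule ℂ F} (h : IsCompl S.range K) (hK : IsClosed (K : Set F)) :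
    IsClosed (S.range : Set F) := by
  have : CompleteSpace K := hK.completeSpace_coe
  -- By the open mapping theorem this surjection is a quotient map, and the range of `S` pulls back
  -- to `E × {0}`.
  let φ : E × K →L[ℂ] F := S.coprod K.subtypeL
  have hφ : Function.Surjective φ := by
    intro x
    obtain ⟨_, ⟨y, rfl⟩, k, hk, hx⟩ := Submodule.mem_sup.1 (h.sup_eq_top ▸ Submodule.mem_top (x := x))
    exact ⟨(y, ⟨k, hk⟩), by simpa [φ] using hx⟩
  have hq := φ.isQuotientMap hφ
  rw [← hq.isClosed_preimage]
  have : φ ⁻¹' (S.range : Set F) = Prod.snd ⁻¹' {(0 : K)} := by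
    ext ⟨y, k⟩
    have : φ (y, k) = S y + k := by simp [φ]
    simp only [Set.mem_preimage, this, SetLike.mem_coe, Set.mem_singleton_iff]
    rw [Submodule.add_mem_iff_right _ (⟨y, rfl⟩ : S y ∈ S.range)]
    constructor
    · intro hk
      exact Subtype.ext (Submodule.disjoint_def.1 h.disjoint k hk k.2)
    · rintro rfl
      exact zero_mem _
  rw [this]
  exact isClosed_singleton.preimage continuous_snd

/-- A Drazin invertible operator is the direct sum of an invertible and a nilpotent operator. -/
lemma IsDrazinInvertible.exists_isRed [CompleteSpace X] {T : X →L[ℂ] X}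
    (h : IsDrazinInvertible T) :
    ∃ (M N : Submodule ℂ X) (hr : IsRed T M N), IsUnit (T.restrict hr.invariant_left) ∧
      IsNilpotent (T.restrict hr.invariant_right) := by
  obtain ⟨n, hran, hcompl, hker⟩ := h.exists_pow
  have hclK : IsClosed ((T ^ n).ker : Set X) := (T ^ n).isClosed_ker
  have hclR : IsClosed ((T ^ n).range : Set X) := isClosed_range_of_isCompl _ hcompl hclK
  have hcomm : ∀ x, (T ^ n) (T x) = T ((T ^ n) x) := fun x =>
    DFunLike.congr_fun (((Commute.refl T).pow_left n).eq) x
  have hr : IsRed T (T ^ n).range (T ^ n).ker :=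
    { isClosed_left := hclR
      isClosed_right := hclK
      invariant_left := by
        rintro _ ⟨y, rfl⟩
        exact ⟨T y, hcomm y⟩
      invariant_right := by
        intro x hx
        simp only [LinearMap.mem_ker, ContinuousLinearMap.coe_coe] at hx ⊢
        rw [hcomm, hx, map_zero]
      isCompl := hcompl }
  refine ⟨_, _, hr, ?_, n, ?_⟩
  · have : CompleteSpace (T ^ n).range := hclR.completeSpace_coe
    rw [ContinuousLinearMap.isUnit_iff_bijective]
    constructor
    · rw [injective_iff_map_eq_zero]
      rintro ⟨x, hx⟩ hx0
      have hx0 : T x = 0 := congrArg Subtype.val hx0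
      refine Subtype.ext (Submodule.disjoint_def.1 hcompl.disjoint x hx ?_)
      -- `T x = 0` puts `x` in the kernel of `T ^ (n + 1)`, which is that of `T ^ n`.
      rw [← hker, pow_succ]
      simp [hx0]
    · rintro ⟨x, hx⟩
      rw [← hran] at hx
      obtain ⟨y, rfl⟩ := hx
      refine ⟨⟨(T ^ n) y, ⟨y, rfl⟩⟩, Subtype.ext ?_⟩
      change T ((T ^ n) y) = (T ^ (n + 1)) y
      rw [pow_succ']
      rfl
  · ext ⟨x, hx⟩
    have hpow : ∀ k (y : (T ^ n).ker), (((T.restrict hr.invariant_right) ^ k) y : X) = (T ^ k) y := by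
      intro k
      induction k with
      | zero => intro y; rfl
      | succ k ih =>
        intro y
        rw [pow_succ, pow_succ]
        exact ih _
    rw [hpow]
    exact hx

end Decomposition

/-! ### Comparison of the three spectra -/

section Spectra

variable {X : Type u} [NormedAddCommGroup X] [NormedSpace ℂ X]

lemma IsRed.sub_smul {T : X →L[ℂ] X} {M N : Submodule ℂ X} (h : IsRed T M N) (z : ℂ) :
    IsRed (T - z • (1 : X →L[ℂ] X)) M N where
  isClosed_left := h.isClosed_left
  isClosed_right := h.isClosed_right
  invariant_left x hx := M.sub_mem (h.invariant_left x hx) (M.smul_mem z hx)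
  invariant_right x hx := N.sub_mem (h.invariant_right x hx) (N.smul_mem z hx)
  isCompl := h.isCompl

lemma restrict_sub_smul {T : X →L[ℂ] X} {M : Submodule ℂ X} (h : ∀ x ∈ M, T x ∈ M) (z : ℂ)
    (h' : ∀ x ∈ M, (T - z • (1 : X →L[ℂ] X)) x ∈ M) :
    (T - z • (1 : X →L[ℂ] X)).restrict h' = T.restrict h - z • (1 : M →L[ℂ] M) :=
  rfl

lemma IsRed.isUnit [CompleteSpace X] {T : X →L[ℂ] X} {M N : Submodule ℂ X} (h : IsRed T M N)
    (hM : IsUnit (T.restrict h.invariant_left)) (hN : IsUnit (T.restrict h.invariant_right)) :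
    IsUnit T := by
  have := h.isClosed_left.completeSpace_coe
  have := h.isClosed_right.completeSpace_coe
  simp only [ContinuousLinearMap.isUnit_iff_bijective] at *
  have hsplit : ∀ x : X, ∃ (m : M) (n : N), (m : X) + n = x := fun x => by
    obtain ⟨m, hm, n, hn, hx⟩ :=
      Submodule.mem_sup.1 (h.isCompl.sup_eq_top ▸ Submodule.mem_top (x := x))
    exact ⟨⟨m, hm⟩, ⟨n, hn⟩, hx⟩
  constructor
  · rw [injective_iff_map_eq_zero]
    intro x hx
    obtain ⟨m, n, rfl⟩ := hsplit x
    rw [map_add] at hx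
    have hm : T m = 0 := Submodule.disjoint_def.1 h.isCompl.disjoint _ (h.invariant_left _ m.2)
      (by rw [eq_neg_of_add_eq_zero_left hx]; exact N.neg_mem (h.invariant_right _ n.2))
    have hn : T n = 0 := by rwa [hm, zero_add] at hx
    have hm' : m = 0 := hM.1 (Subtype.ext (by simpa using hm))
    have hn' : n = 0 := hN.1 (Subtype.ext (by simpa using hn))
    simp [hm', hn']
  · intro x
    obtain ⟨m, n, rfl⟩ := hsplit x
    obtain ⟨m', rfl⟩ := hM.2 m
    obtain ⟨n', rfl⟩ := hN.2 n
    exact ⟨m' + n', by simp⟩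

lemma notMem_spectrum_iff (T : X →L[ℂ] X) (z : ℂ) :
    z ∉ spectrum ℂ T ↔ IsUnit (T - z • (1 : X →L[ℂ] X)) := by
  rw [spectrum.notMem_iff, ← IsUnit.neg_iff, neg_sub, Algebra.algebraMap_eq_smul_one]

/-- For `z ≠ 0`, `z - T` is a unit plus a commuting nilpotent. -/
lemma spectrum_subset_of_isNilpotent {T : X →L[ℂ] X} (h : IsNilpotent T) :
    spectrum ℂ T ⊆ {0} := by
  intro z hz
  by_contra hz0
  refine hz ?_
  rw [spectrum.mem_resolventSet_iff, sub_eq_add_neg]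
  exact h.neg.isUnit_add_left_of_commute ((isUnit_iff_ne_zero.2 hz0).map (algebraMap ℂ (X →L[ℂ] X)))
    (Algebra.commutes' z (-T)).symm

lemma isBrowder_of_isUnit {T : X →L[ℂ] X} (h : IsUnit T) : IsBrowder T := by
  obtain ⟨e, rfl⟩ := h
  set E := ContinuousLinearEquiv.ofUnit e
  have hk : ∀ n : ℕ, ((e : X →L[ℂ] X) ^ n).ker = ⊥ := fun n => by
    rw [← Units.val_pow_eq_pow_val]
    exact LinearMap.ker_eq_bot.2 (ContinuousLinearEquiv.ofUnit (e ^ n)).injective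
  have hr : ∀ n : ℕ, ((e : X →L[ℂ] X) ^ n).range = ⊤ := fun n => by
    rw [← Units.val_pow_eq_pow_val]
    exact LinearMap.range_eq_top.2 (ContinuousLinearEquiv.ofUnit (e ^ n)).surjective
  have hk1 := hk 1
  have hr1 := hr 1
  rw [pow_one] at hk1 hr1
  refine ⟨⟨?_, ?_, ?_, ?_, ?_⟩, ⟨0, ?_⟩, ⟨0, ?_⟩⟩
  · exact E.toHomeomorph.isEmbedding.isStrictMap
  · rw [hr1]; exact isClosed_univ
  · rw [hk1]; infer_instance
  · rw [hr1]; exact Submodule.CoFG.top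
  · rw [hk1]; exact Submodule.closedComplemented_bot
  · rw [hk, hk]
  · rw [hr, hr]

lemma drazinSpectrum_subset_spec (s : SpectrumKind) (T : X →L[ℂ] X) :
    drazinSpectrum T ⊆ s.spec T := by
  cases s with
  | ordinary =>
    intro z hz
    by_contra hn
    exact hz (isBrowder_of_isUnit ((notMem_spectrum_iff T z).1 hn)).2
  | browder => exact fun z hz hb => hz hb.2
  | drazin => exact subset_rfl

lemma spec_subset_spectrum (s : SpectrumKind) (T : X →L[ℂ] X) : s.spec T ⊆ spectrum ℂ T := by
  cases s with
  | ordinary => exact subset_rfl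
  | browder =>
    intro z hz
    by_contra hn
    exact hz (isBrowder_of_isUnit ((notMem_spectrum_iff T z).1 hn))
  | drazin => exact drazinSpectrum_subset_spec .ordinary T

open Topology in
/-- Spectral points that are not in the Drazin spectrum are isolated in the spectrum. -/
lemma derivedSet_spectrum_subset_drazinSpectrum [CompleteSpace X] (T : X →L[ℂ] X) :
    derivedSet (spectrum ℂ T) ⊆ drazinSpectrum T := by
  intro z hz hd
  obtain ⟨M, N, hr, hM, hN⟩ := IsDrazinInvertible.exists_isRed hd
  set S := T - z • (1 : X →L[ℂ] X) with hS
  have := hr.isClosed_left.completeSpace_coe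
  -- Invertibility on `M` persists near `z` because units are open; on `N` nilpotency gives it for
  -- every `w ≠ z`.
  have hopen : ∀ᶠ w in 𝓝 z, IsUnit (S.restrict hr.invariant_left - (w - z) • (1 : M →L[ℂ] M)) := by
    have hc : ContinuousAt
        (fun w : ℂ => S.restrict hr.invariant_left - (w - z) • (1 : M →L[ℂ] M)) z := by
      fun_prop
    have ho : IsOpen {f : M →L[ℂ] M | IsUnit f} := Units.isOpen (R := M →L[ℂ] M)
    refine hc.eventually_mem (ho.mem_nhds ?_)
    have h0 : S.restrict hr.invariant_left - (z - z) • (1 : M →L[ℂ] M) =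
        S.restrict hr.invariant_left := by
      ext x
      simp
    change IsUnit (S.restrict hr.invariant_left - (z - z) • (1 : M →L[ℂ] M))
    rwa [h0]
  refine (accPt_iff_frequently.1 hz) ?_
  filter_upwards [hopen] with w hw
  rintro ⟨hwz, hws⟩
  revert hws
  change w ∉ _
  rw [notMem_spectrum_iff]
  have hTw : T - w • (1 : X →L[ℂ] X) = S - (w - z) • (1 : X →L[ℂ] X) := by
    rw [hS, sub_smul]; abel
  rw [hTw]
  refine (hr.sub_smul (w - z)).isUnit ?_ ?_
  · rwa [restrict_sub_smul hr.invariant_left]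
  · rw [restrict_sub_smul hr.invariant_right, ← notMem_spectrum_iff]
    intro hmem
    exact sub_ne_zero.2 hwz (spectrum_subset_of_isNilpotent hN hmem)

lemma derivedSet_spec_subset [CompleteSpace X] (s s' : SpectrumKind) (T : X →L[ℂ] X) :
    derivedSet (s.spec T) ⊆ s'.spec T :=
  (derivedSet_mono _ _ (spec_subset_spectrum s T)).trans
    ((derivedSet_spectrum_subset_drazinSpectrum T).trans (drazinSpectrum_subset_spec s' T))

/-- The comparison of a spectrum with itself already says that it contains its accumulation points.
-/
lemma isClosed_spec [CompleteSpace X] (s : SpectrumKind) (T : X →L[ℂ] X) :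
    IsClosed (s.spec T) :=
  (isClosed_iff_derivedSet_subset _).2 (derivedSet_spec_subset s s T)

lemma accIter_spec_eq [CompleteSpace X] (s s' : SpectrumKind) (T : X →L[ℂ] X)
    {α : Ordinal.{v}} (hα : ω ≤ α) : accIter (s.spec T) α = accIter (s'.spec T) α := by
  suffices h : ∀ s s' : SpectrumKind, accIter (s.spec T) α ⊆ accIter (s'.spec T) α from
    (h s s').antisymm (h s' s)
  clear s s'
  intro s s'
  induction α using Ordinal.limitRecOn with
  | zero => exact absurd hα (not_le.2 Ordinal.omega0_pos)
  | add_one α ih =>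
    rcases hα.eq_or_lt with h | hlt
    · exact absurd (h ▸ Ordinal.isSuccLimit_omega0) (Order.not_isSuccLimit_add_one _)
    · rw [accIter_add_one, accIter_add_one]
      exact derivedSet_mono _ _ (ih (Order.lt_add_one_iff.1 hlt))
  | limit α hα' ih =>
    rw [accIter_limit _ hα', accIter_limit _ hα']
    refine Set.subset_iInter₂ fun β hβ => ?_
    -- Stage `β + 1` is still below the limit, which pays for the one-step lag.
    exact (Set.biInter_subset_of_mem (hα'.add_one_lt hβ)).trans
      (accIter_add_one_subset (derivedSet_spec_subset s s' T) (isClosed_spec s T) β)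

end Spectra

/-! ### Monotonicity, countable orders and independence of the spectrum -/

section GInvertible

variable {X : Type u} [NormedAddCommGroup X] [NormedSpace ℂ X] {T : X →L[ℂ] X}

lemma isGInvertible_zero (s : SpectrumKind) :
    IsGInvertible s (0 : Ordinal.{v}) T ↔ 0 ∉ s.spec T := by
  rw [IsGInvertible, Ordinal.limitRecOn_zero]

lemma isGInvertible_add_one (s : SpectrumKind) (β : Ordinal.{v}) :
    IsGInvertible s (β + 1) T ↔ ∃ (M N : Submodule ℂ X) (h : IsRed T M N),
      IsUnit (T.restrict h.invariant_left) ∧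
        accIter (s.spec (T.restrict h.invariant_right)) β ⊆ {0} := by
  rw [IsGInvertible, Ordinal.limitRecOn_add_one]

lemma isGInvertible_limit (s : SpectrumKind) {α : Ordinal.{v}} (hα : Order.IsSuccLimit α) :
    IsGInvertible s α T ↔ ∃ β, β + 1 < α ∧ IsGInvertible s (β + 1) T := by
  rw [IsGInvertible, Ordinal.limitRecOn_limit _ _ _ _ hα]
  simp only [exists_prop]
  rfl

variable [CompleteSpace X]

lemma IsGInvertible.add_one_of_add_one_le {s : SpectrumKind} {α β : Ordinal.{v}} (hβα : β ≤ α)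
    (h : IsGInvertible s (β + 1) T) : IsGInvertible s (α + 1) T := by
  rw [isGInvertible_add_one] at h ⊢
  obtain ⟨M, N, hr, hM, hN⟩ := h
  have := hr.isClosed_right.completeSpace_coe
  exact ⟨M, N, hr, hM, (accIter_antitone (isClosed_spec _ _) hβα).trans hN⟩

/-- Since `σ_d ⊆ σ_*`, `T` is Drazin invertible, and its nilpotent part has spectrum inside `{0}`.
-/
lemma IsGInvertible.one_of_zero {s : SpectrumKind} (h : IsGInvertible s (0 : Ordinal.{v}) T) :
    IsGInvertible s (0 + 1 : Ordinal.{v}) T := by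
  rw [isGInvertible_zero] at h
  have hd : IsDrazinInvertible T := by
    have := fun hz => h (drazinSpectrum_subset_spec s T hz)
    simpa [drazinSpectrum] using this
  obtain ⟨M, N, hr, hM, hN⟩ := hd.exists_isRed
  rw [isGInvertible_add_one]
  refine ⟨M, N, hr, hM, ?_⟩
  rw [accIter_zero]
  exact (spec_subset_spectrum s _).trans (spectrum_subset_of_isNilpotent hN)

lemma IsGInvertible.mono {s : SpectrumKind} {α β : Ordinal.{v}} (hβα : β ≤ α)
    (h : IsGInvertible s β T) : IsGInvertible s α T := by
  rcases hβα.eq_or_lt with rfl | hlt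
  · exact h
  -- Invertibility of any order below `α` passes through a successor order at most `α`.
  obtain ⟨γ, hγα, hγ⟩ : ∃ γ, γ + 1 ≤ α ∧ IsGInvertible s (γ + 1) T := by
    induction β using Ordinal.limitRecOn with
    | zero => exact ⟨0, Order.add_one_le_of_lt hlt, h.one_of_zero⟩
    | add_one γ _ => exact ⟨γ, hβα, h⟩
    | limit β hβ _ =>
      obtain ⟨γ, hγβ, hγ⟩ := (isGInvertible_limit s hβ).1 h
      exact ⟨γ, hγβ.le.trans hβα, hγ⟩
  induction α using Ordinal.limitRecOn with
  | zero => exact absurd hlt not_lt_zero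
  | add_one α _ => exact hγ.add_one_of_add_one_le (by simpa using hγα)
  | limit α hα _ =>
    refine (isGInvertible_limit s hα).2 ⟨γ, lt_of_le_of_ne hγα ?_, hγ⟩
    rintro rfl
    exact Order.not_isSuccLimit_add_one _ hα

lemma IsGInvertible.exists_lt_omega_one {s : SpectrumKind} {α : Ordinal.{v}}
    (h : IsGInvertible s α T) : ∃ β < (ω₁ : Ordinal.{v}), IsGInvertible s β T := by
  have hsucc : ∀ β : Ordinal.{v}, IsGInvertible s (β + 1) T →
      ∃ γ < (ω₁ : Ordinal.{v}), IsGInvertible s γ T := by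
    intro β hβ
    obtain ⟨M, N, hr, hM, hN⟩ := (isGInvertible_add_one s β).1 hβ
    have := hr.isClosed_right.completeSpace_coe
    obtain ⟨γ, hγ, hst⟩ := exists_lt_omega_one_accIter_eq
      (isClosed_spec s (T.restrict hr.invariant_right))
    refine ⟨γ + 1, (Cardinal.isSuccLimit_omega 1).add_one_lt hγ,
      (isGInvertible_add_one s γ).2 ⟨M, N, hr, hM, ?_⟩⟩
    -- Stage `max γ β` equals the stable stage `γ` and lies inside stage `β`.
    rw [← hst (max γ β) (le_max_left _ _)]
    exact (accIter_antitone (isClosed_spec _ _) (le_max_right _ _)).trans hN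
  induction α using Ordinal.limitRecOn with
  | zero => exact ⟨0, Ordinal.omega0_pos.trans Ordinal.omega0_lt_omega_one, h⟩
  | add_one β _ => exact hsucc β h
  | limit α hα _ =>
    obtain ⟨β, _, hβ⟩ := (isGInvertible_limit s hα).1 h
    exact hsucc β hβ

lemma IsGInvertible.of_omega0_le {s s' : SpectrumKind} {α : Ordinal.{v}} (hα : ω ≤ α)
    (h : IsGInvertible s α T) : IsGInvertible s' α T := by
  induction α using Ordinal.limitRecOn with
  | zero => exact absurd hα (not_le.2 Ordinal.omega0_pos)
  | add_one α _ =>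
    have hα' : ω ≤ α := by
      rcases hα.eq_or_lt with h' | hlt
      · exact absurd (h' ▸ Ordinal.isSuccLimit_omega0) (Order.not_isSuccLimit_add_one _)
      · exact Order.lt_add_one_iff.1 hlt
    obtain ⟨M, N, hr, hM, hN⟩ := (isGInvertible_add_one s α).1 h
    have := hr.isClosed_right.completeSpace_coe
    exact (isGInvertible_add_one s' α).2 ⟨M, N, hr, hM, (accIter_spec_eq s' s _ hα').trans_subset hN⟩
  | limit α hα' _ =>
    obtain ⟨β, hβα, hβ⟩ := (isGInvertible_limit s hα').1 h
    -- Changing the spectrum costs one more derivative, so order `β + 1` becomes `β + 2`, still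
    -- below the limit.
    refine (isGInvertible_limit s' hα').2 ⟨β + 1, hα'.add_one_lt hβα, ?_⟩
    obtain ⟨M, N, hr, hM, hN⟩ := (isGInvertible_add_one s β).1 hβ
    have := hr.isClosed_right.completeSpace_coe
    exact (isGInvertible_add_one s' _).2 ⟨M, N, hr, hM,
      (accIter_add_one_subset (derivedSet_spec_subset s' s _) (isClosed_spec s' _) β).trans hN⟩

end GInvertible

end CantorBendixsonInvertibility

theorem mainTheorem10 {X : Type u} [NormedAddCommGroup X] [NormedSpace ℂ X] [CompleteSpace X]
    (T : X →L[ℂ] X) :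
    (∀ (s : CantorBendixsonInvertibility.SpectrumKind) (α : Ordinal.{v}), ω₁ ≤ α →
      (CantorBendixsonInvertibility.IsGInvertible s α T ↔
        ∃ β : Ordinal.{v}, β < ω₁ ∧ CantorBendixsonInvertibility.IsGInvertible s β T)) ∧
    (∀ (s s' : CantorBendixsonInvertibility.SpectrumKind) (α : Ordinal.{v}), ω ≤ α →
      (CantorBendixsonInvertibility.IsGInvertible s α T ↔
        CantorBendixsonInvertibility.IsGInvertible s' α T)) := by
  refine ⟨fun s α hα => ⟨fun h => h.exists_lt_omega_one, ?_⟩,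
    fun s s' α hα => ⟨fun h => h.of_omega0_le hα, fun h => h.of_omega0_le hα⟩⟩
  rintro ⟨β, hβ, h⟩
  exact h.mono (hβ.le.trans hα)
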